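/- **Setting.** Pure $\lambda$-terms are taken modulo renaming of bound variables; $(t)u$ denotes application and $(t)u_1\dots u_k=(\dots((t)u_1)\dots)u_k$. $\simeq_\beta$ is $\beta$-equivalence. A step of head reduction goes from $\lambda x_1\dots\lambda x_k\,(\lambda x\,u)\,v\,v_1\dots v_p$ to $\lambda x_1\dots\lambda x_k\,u[v/x]\,v_1\dots v_p$ ($k,p\ge 0$), and $u\succ v$ means that $v$ is obtained from $u$ by finitely many steps of head reduction. $\sigma(t)$ is the result of a simultaneous capture-avoiding substitution $\sigma$ of terms for the free variables of $t$. The Church numeral of $n$ is $\underline n=\lambda x\lambda f\,(f)^n x$. The types of the system $F_\perp$, over a given set of propositional constants, are built from $\perp$, the propositional constants, ordinary propositional variables $X$ and special variables $X_\perp$ (called $\perp$-variables, infinitely many of each kind) by $A\to B$, $\forall X\,A$ and $\forall X_\perp\,A$. The $\perp$-types are generated by: $\perp$ and every $\perp$-variable are $\perp$-types; if $B$ is a $\perp$-type, then so is $A\to B$ for every type $A$; if $A$ is a $\perp$-type, then so is $\forall v\,A$ for every variable $v$ of either kind. The judgement $\Gamma\vdash t:A$, for a context $\Gamma=x_1:A_1,\dots,x_k:A_k$,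 is defined by the rules: 1. $\Gamma\vdash x_i:A_i$; 2. if $\Gamma,x:A\vdash t:B$, then $\Gamma\vdash\lambda x\,t:A\to B$; 3. if $\Gamma\vdash u:A\to B$ and $\Gamma\vdash v:A$, then $\Gamma\vdash (u)v:B$; 4. if $\Gamma\vdash t:A$ and the variable $v$ (of either kind) is not free in $\Gamma$, then $\Gamma\vdash t:\forall v\,A$; 5. if $\Gamma\vdash t:\forall X\,A$ and $G$ is any type, then $\Gamma\vdash t:A[G/X]$; 6. if $\Gamma\vdash t:\forall X_\perp\,A$ and $G$ is a $\perp$-type, then $\Gamma\vdash t:A[G/X_\perp]$. Put $\neg A=A\to\perp$, $\;N=\forall X\,(X\to((X\to X)\to X))$ with $X$ an ordinary variable, and $N^\perp=\forall X_\perp\,(X_\perp\to((X_\perp\to X_\perp)\to X_\perp))$ with $X_\perp$ a $\perp$-variable. **Theorem 5.2.** Let $T$ be a $\lambda$-term such that $\vdash T:N^\perp\to\neg\neg N$ in $F_\perp$ (in the empty context), and let $f$ be a fixed variable. Then for every $n\ge 0$ there are an $m\ge 0$ and a $\lambda$-term $\tau_m\simeq_\beta\underline m$ such that for every $\lambda$-term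 $\theta_n\simeq_\beta\underline n$ there is a substitution $\sigma$ with $(T)\theta_n f\succ (f)\sigma(\tau_m)$. -/

import Mathlib

namespace FPerp

/-! ### Pure lambda terms -/

/-- Pure `λ`-terms modulo renaming of bound variables, with de Bruijn indices.  An index that
exceeds the number of binders above it is a free variable. -/
inductive Term : Type where
  | var (i : ℕ) : Term
  | app (t u : Term) : Term
  | lam (t : Term) : Term

namespace Term

/-- The extension of a renaming of variables under one `λ`. -/
def liftRen (ρ : ℕ → ℕ) : ℕ → ℕ
  | 0 => 0
  | i + 1 => ρ i + 1

/-- Renaming of the free variables of a term. -/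
def rename : (ℕ → ℕ) → Term → Term
  | ρ, var i => var (ρ i)
  | ρ, app t u => app (rename ρ t) (rename ρ u)
  | ρ, lam t => lam (rename (liftRen ρ) t)

/-- The extension of a substitution under one `λ`. -/
def liftSubst (σ : ℕ → Term) : ℕ → Term
  | 0 => var 0
  | i + 1 => rename Nat.succ (σ i)

/-- `subst σ t` is `σ(t)`: the simultaneous, capture-avoiding substitution of `σ i` for each
free variable `i` of `t`. -/
def subst : (ℕ → Term) → Term → Term
  | σ, var i => σ i
  | σ, app t u => app (subst σ t) (subst σ u)
  | σ, lam t => lam (subst (liftSubst σ) t)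

/-- The substitution that puts `v` for the variable bound by an outermost `λ` that is being
removed, and leaves every other variable alone. -/
def single (v : Term) : ℕ → Term
  | 0 => v
  | i + 1 => var i

/-- The contractum `u[v/x]` of the redex `(λx u)v`. -/
def contract (u v : Term) : Term := subst (single v) u

/-- One step of `β`-reduction, anywhere in a term. -/
inductive Beta : Term → Term → Prop where
  | beta (u v : Term) : Beta (app (lam u) v) (contract u v)
  | appL {t t' : Term} (u : Term) : Beta t t' → Beta (app t u) (app t' u)
  | appR (t : Term) {u u' : Term} : Beta u u' → Beta (app t u) (app t u')
  | lam {t t' : Term} : Beta t t' → Beta (lam t) (lam t')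

/-- `β`-equivalence. -/
def BetaEq : Term → Term → Prop := Relation.EqvGen Beta

/-- `(λx u) v v₁ … vₘ` goes to `u[v/x] v₁ … vₘ`: contraction of the head redex of a term that
does not begin with `λ`. -/
inductive SpineStep : Term → Term → Prop where
  | beta (u v : Term) : SpineStep (app (lam u) v) (contract u v)
  | app {t t' : Term} (w : Term) : SpineStep t t' → SpineStep (app t w) (app t' w)

/-- One step of head reduction: `λx₁ … λxₙ (λx u) v v₁ … vₘ` goes to
`λx₁ … λxₙ u[v/x] v₁ … vₘ`. -/
inductive HeadStep : Term → Term → Prop where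
  | spine {t t' : Term} : SpineStep t t' → HeadStep t t'
  | lam {t t' : Term} : HeadStep t t' → HeadStep (lam t) (lam t')

/-- `u ≻ v`: `v` is obtained from `u` by finitely many (possibly no) head reduction steps. -/
def HeadRed : Term → Term → Prop := Relation.ReflTransGen HeadStep

/-- The Church numeral `λx λf (f)ⁿ x`. -/
def church (n : ℕ) : Term := lam (lam ((app (var 0))^[n] (var 1)))

end Term

/-! ### Types -/

/-- The two kinds of propositional variables: ordinary ones and `⊥`-variables. -/
inductive Kind : Type where
  | ord : Kind
  | perp : Kind
  deriving DecidableEq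

/-- The types of the system `F_⊥` over a set `C` of propositional constants, modulo renaming of
bound variables.  Variables are de Bruijn indices, counted separately for each kind: `all k`
binds the variable `0` of kind `k`, and does not affect the variables of the other kind. -/
inductive Ty (C : Type*) : Type _ where
  | bot : Ty C
  | const (c : C) : Ty C
  | var (k : Kind) (i : ℕ) : Ty C
  | arr (A B : Ty C) : Ty C
  | all (k : Kind) (A : Ty C) : Ty C

namespace Ty

variable {C : Type*}

/-- The renaming that makes room for a new variable `0` of kind `k`. -/
def shift (k k' : Kind) (i : ℕ) : ℕ := if k' = k then i + 1 else i

/-- The extension of a renaming under a quantifier of kind `k`. -/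
def liftRen (k : Kind) (ρ : Kind → ℕ → ℕ) (k' : Kind) : ℕ → ℕ
  | 0 => if k' = k then 0 else ρ k' 0
  | i + 1 => if k' = k then ρ k' i + 1 else ρ k' (i + 1)

/-- Renaming of the free variables of a type. -/
def rename : (Kind → ℕ → ℕ) → Ty C → Ty C
  | _, bot => bot
  | _, const c => const c
  | ρ, var k i => var k (ρ k i)
  | ρ, arr A B => arr (rename ρ A) (rename ρ B)
  | ρ, all k A => all k (rename (liftRen k ρ) A)

/-- The type `A`, seen in the scope of one more quantifier of kind `k` whose variable does not
occur in it. -/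
def weaken (k : Kind) (A : Ty C) : Ty C := rename (shift k) A

/-- The extension of a substitution under a quantifier of kind `k`. -/
def liftSubst (k : Kind) (σ : Kind → ℕ → Ty C) (k' : Kind) : ℕ → Ty C
  | 0 => if k' = k then var k' 0 else weaken k (σ k' 0)
  | i + 1 => if k' = k then weaken k (σ k' i) else weaken k (σ k' (i + 1))

/-- Simultaneous capture-avoiding substitution of types for the free variables of a type. -/
def subst : (Kind → ℕ → Ty C) → Ty C → Ty C
  | _, bot => bot
  | _, const c => const c
  | σ, var k i => σ k i
  | σ, arr A B => arr (subst σ A) (subst σ B)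
  | σ, all k A => all k (subst (liftSubst k σ) A)

/-- The substitution of `G` for the variable `0` of kind `k`, for a quantifier of kind `k` that is
being removed. -/
def single (k : Kind) (G : Ty C) (k' : Kind) : ℕ → Ty C
  | 0 => if k' = k then G else var k' 0
  | i + 1 => if k' = k then var k' i else var k' (i + 1)

/-- `inst k A G` is `A[G/X]`, where `A` is the body of the type `∀X A` and `X` is of kind `k`. -/
def inst (k : Kind) (A G : Ty C) : Ty C := subst (single k G) A

/-- The `⊥`-types: those that end with `⊥` or with a `⊥`-variable. -/
inductive IsPerp : Ty C → Prop where
  | bot : IsPerp bot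
  | var (i : ℕ) : IsPerp (var Kind.perp i)
  | arr (A : Ty C) {B : Ty C} : IsPerp B → IsPerp (arr A B)
  | all (k : Kind) {A : Ty C} : IsPerp A → IsPerp (all k A)

/-- `¬A`, that is `A → ⊥`. -/
def neg (A : Ty C) : Ty C := arr A bot

/-- The type `∀X {X, (X → X) → X}`, for a variable `X` of kind `k`. -/
def natOf (k : Kind) : Ty C :=
  all k (arr (var k 0) (arr (arr (var k 0) (var k 0)) (var k 0)))

/-- The type `N` of integers: `∀X {X, (X → X) → X}` with `X` an ordinary variable. -/
def nat : Ty C := natOf Kind.ord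

/-- The type `N^⊥`: `∀X {X, (X → X) → X}` with `X` a `⊥`-variable. -/
def natPerp : Ty C := natOf Kind.perp

end Ty

/-- The typing judgement `Γ ⊢ t : A` of the system `F_⊥`, in the style of Curry.  The context
`Γ` lists the types of the free variables `0, 1, 2, …` of `t`. -/
inductive Typing {C : Type*} : List (Ty C) → Term → Ty C → Prop where
  | var {Γ : List (Ty C)} {i : ℕ} {A : Ty C} :
      Γ[i]? = some A → Typing Γ (Term.var i) A
  | lam {Γ : List (Ty C)} {t : Term} {A B : Ty C} :
      Typing (A :: Γ) t B → Typing Γ (Term.lam t) (Ty.arr A B)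
  | app {Γ : List (Ty C)} {u v : Term} {A B : Ty C} :
      Typing Γ u (Ty.arr A B) → Typing Γ v A → Typing Γ (Term.app u v) B
  /-- Generalization over a variable of either kind that is not free in the context. -/
  | gen {Γ : List (Ty C)} {t : Term} (k : Kind) {A : Ty C} :
      Typing (Γ.map (Ty.weaken k)) t A → Typing Γ t (Ty.all k A)
  /-- An ordinary variable may be replaced by any type. -/
  | instOrd {Γ : List (Ty C)} {t : Term} {A : Ty C} (G : Ty C) :
      Typing Γ t (Ty.all Kind.ord A) → Typing Γ t (Ty.inst Kind.ord A G)
  /-- A `⊥`-variable may be replaced by `⊥`-types only. -/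
  | instPerp {Γ : List (Ty C)} {t : Term} {A : Ty C} (G : Ty C) :
      G.IsPerp → Typing Γ t (Ty.all Kind.perp A) → Typing Γ t (Ty.inst Kind.perp A G)

end FPerp

namespace FPerp

namespace Term

/-! ### Substitution calculus -/

/-! The proof is by realizability, with `⊥` interpreted by the set `Returns f n`. Ordinary variables
range over all sets closed under weak head expansion, `⊥`-variables only over orthogonals of
`Returns f n`, that is, sets defined by tests on argument lists. Every typable term realizes its
type (`Typing.mem_interp`).

Since `m` and `τ` must not depend on `θ`, the variable `f + 1` stands for an unknown numeral. Given
`a` and `b`, it yields a variable naming the suspended value `(b)ⁿ a`, unfolded one layer at a time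
in head position. Orthogonality makes `f + 1` a realizer of `N^⊥` (`var_mem_interp_natPerp`). A
realizer of `N` is a numeral up to `β` (`exists_betaEq_church_of_mem_interp_nat`), so `f` realizes
`¬N`. Hence `(T)(f+1) f` lies in `Returns f n`, and its derivation fixes `m` and `τ`
(`Returns.exists_spineRed`). For each `θ`, standardization supplies actual terms for the names
(`exists_realizes`), and substituting them gives the reduction of `(T)θ f`. -/

theorem liftRen_comp (ρ ρ' : ℕ → ℕ) : liftRen ρ ∘ liftRen ρ' = liftRen (ρ ∘ ρ') := by
  funext i; cases i <;> rfl

theorem rename_rename (ρ ρ' : ℕ → ℕ) (t : Term) :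
    rename ρ (rename ρ' t) = rename (ρ ∘ ρ') t := by
  induction t generalizing ρ ρ' with
  | var i => rfl
  | app t u iht ihu => simp [rename, iht, ihu]
  | lam t ih => simp [rename, ih, liftRen_comp]

theorem liftSubst_comp_liftRen (σ : ℕ → Term) (ρ : ℕ → ℕ) :
    liftSubst σ ∘ liftRen ρ = liftSubst (σ ∘ ρ) := by
  funext i; cases i <;> rfl

theorem subst_rename (σ : ℕ → Term) (ρ : ℕ → ℕ) (t : Term) :
    subst σ (rename ρ t) = subst (σ ∘ ρ) t := by
  induction t generalizing σ ρ with
  | var i => rfl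
  | app t u iht ihu => simp [rename, subst, iht, ihu]
  | lam t ih => simp [rename, subst, ih, liftSubst_comp_liftRen]

theorem rename_liftRen_comp_liftSubst (ρ : ℕ → ℕ) (σ : ℕ → Term) :
    rename (liftRen ρ) ∘ liftSubst σ = liftSubst (rename ρ ∘ σ) := by
  funext i
  cases i with
  | zero => rfl
  | succ i => simp only [Function.comp, liftSubst, rename_rename]; rfl

theorem rename_subst (ρ : ℕ → ℕ) (σ : ℕ → Term) (t : Term) :
    rename ρ (subst σ t) = subst (rename ρ ∘ σ) t := by
  induction t generalizing σ ρ with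
  | var i => rfl
  | app t u iht ihu => simp [rename, subst, iht, ihu]
  | lam t ih => simp [rename, subst, ih, rename_liftRen_comp_liftSubst]

theorem subst_liftSubst_comp_liftSubst (σ τ : ℕ → Term) :
    subst (liftSubst σ) ∘ liftSubst τ = liftSubst (subst σ ∘ τ) := by
  funext i
  cases i with
  | zero => rfl
  | succ i => simp only [Function.comp, liftSubst, subst_rename, rename_subst]; rfl

theorem subst_subst (σ τ : ℕ → Term) (t : Term) :
    subst σ (subst τ t) = subst (subst σ ∘ τ) t := by
  induction t generalizing σ τ with
  | var i => rfl
  | app t u iht ihu => simp [subst, iht, ihu]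
  | lam t ih => simp [subst, ih, subst_liftSubst_comp_liftSubst]

theorem liftSubst_var_comp (ρ : ℕ → ℕ) : liftSubst (var ∘ ρ) = var ∘ liftRen ρ := by
  funext i; cases i <;> rfl

theorem subst_var_comp (ρ : ℕ → ℕ) (t : Term) : subst (var ∘ ρ) t = rename ρ t := by
  induction t generalizing ρ with
  | var i => rfl
  | app t u iht ihu => simp [rename, subst, iht, ihu]
  | lam t ih => simp [rename, subst, ih, liftSubst_var_comp]

/-- A strict upper bound for the free variables of a term. -/
def bound : Term → ℕ
  | var i => i + 1
  | app t u => max (bound t) (bound u)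
  | lam t => bound t

theorem subst_congr {σ τ : ℕ → Term} {t : Term} (h : ∀ i < t.bound, σ i = τ i) :
    subst σ t = subst τ t := by
  induction t generalizing σ τ with
  | var i => exact h i (Nat.lt_succ_self i)
  | app t u iht ihu =>
    simp only [bound, lt_max_iff] at h
    simp only [subst]
    rw [iht fun i hi => h i (.inl hi), ihu fun i hi => h i (.inr hi)]
  | lam t ih =>
    simp only [subst]
    rw [ih]
    rintro (_ | i) hi
    · rfl
    · simp only [liftSubst]
      rw [h i (Nat.lt_of_succ_lt hi)]

/-- The substitution of `v` for the variable `0` and of `σ i` for the variable `i + 1`. -/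
def cons (v : Term) (σ : ℕ → Term) : ℕ → Term
  | 0 => v
  | i + 1 => σ i

theorem subst_var (t : Term) : subst var t = t := by
  have h : liftSubst var = var := by funext i; cases i <;> rfl
  induction t with
  | var i => rfl
  | app t u iht ihu => simp [subst, iht, ihu]
  | lam t ih => simp [subst, h, ih]

theorem contract_subst_liftSubst (σ : ℕ → Term) (t v : Term) :
    contract (subst (liftSubst σ) t) v = subst (cons v σ) t := by
  rw [contract, subst_subst]
  congr 1
  funext i
  cases i with
  | zero => rfl
  | succ i => exact (subst_rename _ _ _).trans (subst_var _)

theorem subst_contract (σ : ℕ → Term) (t v : Term) :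
    subst σ (contract t v) = contract (subst (liftSubst σ) t) (subst σ v) := by
  rw [contract_subst_liftSubst, contract, subst_subst]
  congr 1
  funext i
  cases i <;> rfl

theorem rename_contract (ρ : ℕ → ℕ) (t v : Term) :
    rename ρ (contract t v) = contract (rename (liftRen ρ) t) (rename ρ v) := by
  rw [← subst_var_comp, subst_contract, liftSubst_var_comp, subst_var_comp, subst_var_comp]

theorem contract_rename_liftRen_succ (t : Term) :
    contract (rename (liftRen Nat.succ) t) (var 0) = t := by
  rw [contract, subst_rename]
  conv_rhs => rw [← subst_var t]
  congr 1
  funext i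
  cases i <;> rfl

/-! ### Beta reduction and beta equivalence -/

/-- Reduction in finitely many steps. -/
abbrev BetaStar : Term → Term → Prop := Relation.ReflTransGen Beta

/-- Weak head reduction in finitely many steps. -/
abbrev SpineRed : Term → Term → Prop := Relation.ReflTransGen SpineStep

theorem SpineStep.toBeta {t t' : Term} (h : SpineStep t t') : Beta t t' := by
  induction h with
  | beta u v => exact .beta u v
  | app w _ ih => exact .appL w ih

theorem SpineRed.toBetaStar {t t' : Term} (h : SpineRed t t') : BetaStar t t' :=
  h.lift id fun _ _ => SpineStep.toBeta

theorem BetaStar.toBetaEq {t t' : Term} (h : BetaStar t t') : BetaEq t t' := by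
  induction h with
  | refl => exact .refl _
  | tail _ h ih => exact .trans _ _ _ ih (.rel _ _ h)

theorem SpineRed.toBetaEq {t t' : Term} (h : SpineRed t t') : BetaEq t t' :=
  h.toBetaStar.toBetaEq

theorem SpineRed.toHeadRed {t t' : Term} (h : SpineRed t t') : HeadRed t t' :=
  h.lift id fun _ _ => HeadStep.spine

theorem BetaStar.appL {t t' : Term} (u : Term) (h : BetaStar t t') :
    BetaStar (app t u) (app t' u) :=
  h.lift (fun t => app t u) fun _ _ => Beta.appL u

theorem BetaStar.appR (t : Term) {u u' : Term} (h : BetaStar u u') :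
    BetaStar (app t u) (app t u') :=
  h.lift (app t) fun _ _ => Beta.appR t

theorem BetaStar.lam {t t' : Term} (h : BetaStar t t') : BetaStar (lam t) (lam t') :=
  h.lift Term.lam fun _ _ => Beta.lam

theorem SpineRed.app {t t' : Term} (u : Term) (h : SpineRed t t') :
    SpineRed (app t u) (app t' u) :=
  h.lift (fun t => Term.app t u) fun _ _ => SpineStep.app u

theorem BetaEq.map {F : Term → Term} (hF : ∀ t t', Beta t t' → Beta (F t) (F t'))
    {t t' : Term} (h : BetaEq t t') : BetaEq (F t) (F t') := by
  induction h with
  | rel _ _ h => exact .rel _ _ (hF _ _ h)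
  | refl => exact .refl _
  | symm _ _ _ ih => exact .symm _ _ ih
  | trans _ _ _ _ _ ih ih' => exact .trans _ _ _ ih ih'

theorem Beta.subst {t t' : Term} (h : Beta t t') (σ : ℕ → Term) :
    Beta (subst σ t) (subst σ t') := by
  induction h generalizing σ with
  | beta u v => rw [subst_contract]; exact .beta _ _
  | appL u _ ih => exact .appL _ (ih σ)
  | appR t _ ih => exact .appR _ (ih σ)
  | lam _ ih => exact .lam (ih _)

theorem Beta.rename {t t' : Term} (h : Beta t t') (ρ : ℕ → ℕ) :
    Beta (rename ρ t) (rename ρ t') := by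
  simpa only [subst_var_comp] using h.subst (var ∘ ρ)

theorem BetaStar.rename {t t' : Term} (h : BetaStar t t') (ρ : ℕ → ℕ) :
    BetaStar (rename ρ t) (rename ρ t') :=
  h.lift (Term.rename ρ) fun _ _ h => h.rename ρ

theorem betaStar_subst {σ τ : ℕ → Term} (h : ∀ i, BetaStar (σ i) (τ i)) (t : Term) :
    BetaStar (subst σ t) (subst τ t) := by
  induction t generalizing σ τ with
  | var i => exact h i
  | app t u iht ihu => exact ((iht h).appL _).trans ((ihu h).appR _)
  | lam t ih =>
    refine BetaStar.lam (ih fun i => ?_)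
    cases i with
    | zero => exact .refl
    | succ i => exact (h i).rename _

theorem SpineStep.subst {t t' : Term} (h : SpineStep t t') (σ : ℕ → Term) :
    SpineStep (subst σ t) (subst σ t') := by
  induction h with
  | beta u v => rw [subst_contract]; exact .beta _ _
  | app w _ ih => exact .app _ ih

theorem SpineRed.subst {t t' : Term} (h : SpineRed t t') (σ : ℕ → Term) :
    SpineRed (subst σ t) (subst σ t') :=
  h.lift (Term.subst σ) fun _ _ h => h.subst σ

theorem SpineRed.rename {t t' : Term} (h : SpineRed t t') (ρ : ℕ → ℕ) :
    SpineRed (rename ρ t) (rename ρ t') := by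
  simpa only [subst_var_comp] using h.subst (var ∘ ρ)

/-- A renaming sends variables to variables, so it creates no redex, even when it is not injective.
-/
theorem SpineStep.of_rename {ρ : ℕ → ℕ} {t u : Term} (h : SpineStep (rename ρ t) u) :
    ∃ u', SpineStep t u' ∧ u = rename ρ u' := by
  induction t generalizing u with
  | var i => cases h
  | lam t _ => cases h
  | app t v iht _ =>
    rw [Term.rename] at h
    generalize ht : Term.rename ρ t = s at h
    cases h with
    | beta p q =>
      cases t with
      | var i => cases ht
      | app a b => cases ht
      | lam a =>
        cases ht
        exact ⟨_, .beta a v, (rename_contract _ _ _).symm⟩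
    | app w h =>
      subst ht
      obtain ⟨u', hu, rfl⟩ := iht h
      exact ⟨_, .app v hu, rfl⟩

theorem SpineRed.of_rename {ρ : ℕ → ℕ} {t u : Term} (h : SpineRed (Term.rename ρ t) u) :
    ∃ u', SpineRed t u' ∧ u = Term.rename ρ u' := by
  induction h with
  | refl => exact ⟨t, .refl, rfl⟩
  | tail _ h ih =>
    obtain ⟨u', hu, rfl⟩ := ih
    obtain ⟨v, hv, rfl⟩ := h.of_rename
    exact ⟨v, hu.tail hv, rfl⟩

theorem SpineRed.of_rename_lam {ρ : ℕ → ℕ} {t u : Term}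
    (h : SpineRed (Term.rename ρ t) (lam u)) : ∃ u', SpineRed t (lam u') := by
  obtain ⟨v, hv, e⟩ := h.of_rename
  cases v with
  | var i => cases e
  | app a b => cases e
  | lam a => exact ⟨a, hv⟩

/-- A weak head reduction of an application either stays in the function or contracts it. -/
theorem SpineRed.app_inv {t v w : Term} (h : SpineRed (Term.app t v) w) :
    (∃ t', SpineRed t t' ∧ w = Term.app t' v) ∨ ∃ p, SpineRed t (Term.lam p) := by
  induction h with
  | refl => exact .inl ⟨t, .refl, rfl⟩
  | tail _ h ih =>
    obtain ⟨t', ht, rfl⟩ | hp := ih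
    · cases h with
      | beta p q => exact .inr ⟨p, ht⟩
      | app w h => exact .inl ⟨_, ht.tail h, rfl⟩
    · exact .inr hp

/-! ### Standardization -/

/-- Standard reductions: weak head reduction, followed by standard reductions of the immediate
subterms. -/
inductive Standard : Term → Term → Prop where
  | var {t : Term} {i : ℕ} : SpineRed t (var i) → Standard t (var i)
  | app {t a b a' b' : Term} :
      SpineRed t (app a b) → Standard a a' → Standard b b' → Standard t (app a' b')
  | lam {t a a' : Term} : SpineRed t (lam a) → Standard a a' → Standard t (lam a')

theorem Standard.refl (t : Term) : Standard t t := by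
  induction t with
  | var i => exact .var .refl
  | app t u iht ihu => exact .app .refl iht ihu
  | lam t ih => exact .lam .refl ih

theorem Standard.spineRed {t u s : Term} (h : SpineRed t u) (hs : Standard u s) :
    Standard t s := by
  cases hs with
  | var h' => exact .var (h.trans h')
  | app h' ha hb => exact .app (h.trans h') ha hb
  | lam h' ha => exact .lam (h.trans h') ha

theorem Standard.rename {t s : Term} (h : Standard t s) (ρ : ℕ → ℕ) :
    Standard (rename ρ t) (rename ρ s) := by
  induction h generalizing ρ with
  | var h => exact .var (h.rename ρ)
  | app h _ _ iha ihb => exact .app (h.rename ρ) (iha ρ) (ihb ρ)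
  | lam h _ ih => exact .lam (h.rename ρ) (ih _)

theorem Standard.subst {t s : Term} (h : Standard t s) {σ τ : ℕ → Term}
    (hσ : ∀ i, Standard (σ i) (τ i)) : Standard (subst σ t) (subst τ s) := by
  induction h generalizing σ τ with
  | var h => exact (hσ _).spineRed (h.subst σ)
  | app h _ _ iha ihb => exact .app (h.subst σ) (iha hσ) (ihb hσ)
  | lam h _ ih =>
    refine .lam (h.subst σ) (ih fun i => ?_)
    cases i with
    | zero => exact .refl _
    | succ i => exact (hσ i).rename _

/-- A contraction is absorbed into a standard reduction. When its redex is the whole term, the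
source already has a redex at its head after weak head reduction; that one is contracted first, and
`Standard.subst` handles the rest. -/
theorem Standard.beta {t s s' : Term} (h : Standard t s) (hs : Beta s s') : Standard t s' := by
  induction hs generalizing t with
  | beta u v =>
    obtain _ | @⟨_, a, b, _, _, h, ha, hb⟩ := h
    obtain _ | _ | @⟨_, p, _, hp, hpu⟩ := ha
    refine Standard.spineRed ((h.trans (hp.app b)).tail (.beta p b)) (hpu.subst fun i => ?_)
    cases i with
    | zero => exact hb
    | succ i => exact .refl _
  | appL u _ ih =>
    obtain _ | ⟨h, ha, hb⟩ := h
    exact .app h (ih ha) hb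
  | appR u _ ih =>
    obtain _ | ⟨h, ha, hb⟩ := h
    exact .app h ha (ih hb)
  | lam _ ih =>
    obtain _ | _ | ⟨h, ha⟩ := h
    exact .lam h (ih ha)

/-- The standardization theorem. -/
theorem BetaStar.standard {t s : Term} (h : BetaStar t s) : Standard t s := by
  induction h with
  | refl => exact .refl t
  | tail _ h ih => exact ih.beta h

/-- A `β`-step cannot duplicate the weak head redex, so at most one residual is left. This bound
lets the diagram be iterated without full confluence. -/
theorem Beta.spineStep_strip {t t' u : Term} (h : Beta t t') (hu : SpineStep t u) :
    ∃ u', (t' = u' ∨ SpineStep t' u') ∧ BetaStar u u' := by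
  induction hu generalizing t' with
  | beta p q =>
    cases h with
    | beta => exact ⟨_, .inl rfl, .refl⟩
    | appL _ h =>
      cases h with
      | lam h => exact ⟨_, .inr (.beta _ _), .single (h.subst _)⟩
    | appR _ h =>
      refine ⟨_, .inr (.beta _ _), betaStar_subst (fun i => ?_) p⟩
      cases i with
      | zero => exact .single h
      | succ i => exact .refl
  | @app a a' w hs ih =>
    cases h with
    | beta p q => cases hs
    | appL _ h =>
      obtain ⟨u', hu | hu, hb⟩ := ih h
      · exact ⟨_, .inl (congrArg (Term.app · w) hu), hb.appL w⟩
      · exact ⟨_, .inr (hu.app w), hb.appL w⟩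
    | appR _ h => exact ⟨_, .inr (hs.app _), .single (.appR _ h)⟩

theorem BetaStar.spineStep_strip {t t' u : Term} (h : BetaStar t t') (hu : SpineStep t u) :
    ∃ u', SpineRed t' u' ∧ BetaStar u u' := by
  suffices ∃ u', (t' = u' ∨ SpineStep t' u') ∧ BetaStar u u' by
    obtain ⟨u', rfl | h, hb⟩ := this
    · exact ⟨_, .refl, hb⟩
    · exact ⟨_, .single h, hb⟩
  induction h with
  | refl => exact ⟨u, .inr hu, .refl⟩
  | tail _ h ih =>
    obtain ⟨u', rfl | hs, hb⟩ := ih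
    · exact ⟨_, .inl rfl, hb.tail h⟩
    · obtain ⟨v, hv, hbv⟩ := h.spineStep_strip hs
      exact ⟨v, hv, hb.trans hbv⟩

theorem SpineRed.betaStar_strip {t t' u : Term} (hu : SpineRed t u) (h : BetaStar t t') :
    ∃ u', SpineRed t' u' ∧ BetaStar u u' := by
  induction hu with
  | refl => exact ⟨t', .refl, h⟩
  | tail _ hs ih =>
    obtain ⟨v, hv, hb⟩ := ih
    obtain ⟨w, hw, hbw⟩ := hb.spineStep_strip hs
    exact ⟨w, hv.trans hw, hbw⟩

/-! ### Terms that compute an iteration -/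

/-- `Iterates x g n t`: weak head reduction exhibits `t` as `(g)ⁿ x`, one `g` after another. -/
def Iterates (x g : ℕ) : ℕ → Term → Prop
  | 0, t => SpineRed t (var x)
  | n + 1, t => ∃ b, SpineRed t (app (var g) b) ∧ Iterates x g n b

variable {x g n : ℕ}

theorem Iterates.spineRed {t t' : Term} (h : SpineRed t t') (ht : Iterates x g n t') :
    Iterates x g n t := by
  cases n with
  | zero => exact h.trans ht
  | succ n => exact ht.imp fun _ hb => ⟨h.trans hb.1, hb.2⟩

theorem Iterates.betaStar {t : Term} (h : Iterates x g n t) :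
    BetaStar t ((app (var g))^[n] (var x)) := by
  induction n generalizing t with
  | zero => exact h.toBetaStar
  | succ n ih =>
    obtain ⟨b, hb, h⟩ := h
    rw [Function.iterate_succ_apply']
    exact hb.toBetaStar.trans ((ih h).appR _)

theorem betaStar_var {i : ℕ} {t : Term} (h : BetaStar (var i) t) : t = var i := by
  induction h with
  | refl => rfl
  | tail _ h ih => subst ih; cases h

theorem betaStar_app_var {i : ℕ} {b t : Term} (h : BetaStar (app (var i) b) t) :
    ∃ b', t = app (var i) b' ∧ BetaStar b b' := by
  induction h with
  | refl => exact ⟨b, rfl, .refl⟩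
  | tail _ h ih =>
    obtain ⟨b', rfl, hb⟩ := ih
    cases h with
    | appL _ h => cases h
    | appR _ h => exact ⟨_, rfl, hb.tail h⟩

theorem Iterates.of_betaStar {t t' : Term} (h : BetaStar t t') (ht : Iterates x g n t) :
    Iterates x g n t' := by
  induction n generalizing t t' with
  | zero =>
    obtain ⟨u, hu, hb⟩ := SpineRed.betaStar_strip ht h
    rwa [betaStar_var hb] at hu
  | succ n ih =>
    obtain ⟨b, hb, ht⟩ := ht
    obtain ⟨u, hu, hbu⟩ := hb.betaStar_strip h
    obtain ⟨b', rfl, hb'⟩ := betaStar_app_var hbu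
    exact ⟨b', hu, ih hb' ht⟩

theorem Iterates.of_standard {t : Term} (h : Standard t ((app (var g))^[n] (var x))) :
    Iterates x g n t := by
  induction n generalizing t with
  | zero => cases h with | var h => exact h
  | succ n ih =>
    rw [Function.iterate_succ_apply'] at h
    obtain _ | ⟨h, ha, hb⟩ := h
    cases ha with
    | var ha => exact ⟨_, h.trans (ha.app _), ih hb⟩

/-- Stripping carries the property forward along `β`, and standardization carries it backward. -/
theorem iterates_congr {t t' : Term} (h : BetaEq t t') :
    Iterates x g n t ↔ Iterates x g n t' := by
  induction h with
  | rel t t' h =>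
    exact ⟨.of_betaStar (.single h), fun h' => .of_standard (BetaStar.standard (h'.betaStar.head h))⟩
  | refl => rfl
  | symm _ _ _ ih => exact ih.symm
  | trans _ _ _ _ _ ih ih' => exact ih.trans ih'

theorem iterates_iterate (x g n : ℕ) : Iterates x g n ((app (var g))^[n] (var x)) :=
  .of_standard (.refl _)

theorem Iterates.rename {t : Term} (h : Iterates x g n t) (ρ : ℕ → ℕ) :
    Iterates (ρ x) (ρ g) n (rename ρ t) := by
  induction n generalizing t with
  | zero => exact SpineRed.rename h ρ
  | succ n ih =>
    obtain ⟨b, hb, h⟩ := h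
    exact ⟨_, hb.rename ρ, ih h⟩

theorem not_iterates_var (h : g ≠ x) : ¬ Iterates x g n (var g) := by
  cases n with
  | zero =>
    intro h'
    have := betaStar_var (SpineRed.toBetaStar h')
    exact h (Term.var.inj this).symm
  | succ n =>
    rintro ⟨b, hb, -⟩
    cases betaStar_var hb.toBetaStar

/-- Otherwise the last argument `g` would survive in a reduct that is either `x` or `(g)b`. The
first is not an application; the second forces `b = g`, which is no iterate. Thus no `η`-step is
needed to recover the abstractions of a numeral. -/
theorem Iterates.exists_lam {t : Term} (hgx : g ≠ x) (h : Iterates x g n (app t (var g))) :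
    ∃ p, SpineRed t (lam p) := by
  cases n with
  | zero => exact (SpineRed.app_inv h).resolve_left fun ⟨_, _, e⟩ => by cases e
  | succ n =>
    obtain ⟨b, hb, h⟩ := h
    refine hb.app_inv.resolve_left ?_
    rintro ⟨_, _, e⟩
    cases e
    exact not_iterates_var hgx h

/-- A term that is applied to two fresh variables. -/
def expand (t : Term) : Term := app (app (rename (· + 2) t) (var 1)) (var 0)

theorem betaEq_expand_church (n : ℕ) :
    BetaEq (expand (church n)) ((app (var 0))^[n] (var 1)) := by
  have hs (σ : ℕ → Term) (a b : Term) (n : ℕ) :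
      subst σ ((app a)^[n] b) = (app (subst σ a))^[n] (subst σ b) := by
    induction n with
    | zero => rfl
    | succ n ih => rw [Function.iterate_succ_apply', Function.iterate_succ_apply', subst, ih]
  have e (n : ℕ) : contract (rename (liftRen (· + 2)) (lam ((app (var 0))^[n] (var 1)))) (var 1) =
      lam ((app (var 0))^[n] (var 2)) := by
    rw [← subst_var_comp]
    simp only [contract, subst, hs]
    rfl
  have e' : contract ((app (var 0))^[n] (var 2)) (var 0) = (app (var 0))^[n] (var 1) := by
    rw [contract, hs]
    rfl
  refine SpineRed.toBetaEq (.trans (.single (.app _ (.beta _ _))) ?_)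
  rw [e]
  conv_rhs => rw [← e']
  exact .single (.beta _ _)

theorem iterates_expand {t : Term} (h : BetaEq t (church n)) : Iterates 1 0 n (expand t) := by
  have h' : BetaEq (expand t) (expand (church n)) :=
    h.map fun _ _ h => .appL _ (.appL _ (h.rename _))
  exact (iterates_congr (h'.trans _ _ _ (betaEq_expand_church n))).2 (iterates_iterate _ _ _)

theorem rename_succ_rename_succ (t : Term) :
    rename Nat.succ (rename Nat.succ t) = rename (· + 2) t := rename_rename _ _ _

theorem betaEq_church_of_iterates_expand {t : Term} (h : Iterates 1 0 n (expand t)) :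
    BetaEq t (church n) := by
  obtain ⟨q, hq⟩ := Iterates.exists_lam (by decide) h
  have e : app (rename (· + 2) t) (var 1) = rename Nat.succ (app (rename Nat.succ t) (var 0)) := by
    rw [Term.rename, rename_succ_rename_succ]; rfl
  obtain ⟨q, hq⟩ := SpineRed.of_rename_lam (e ▸ hq)
  obtain ⟨r, hr⟩ := hq.app_inv.resolve_left fun ⟨_, _, e⟩ => by cases e
  obtain ⟨r, hr⟩ := hr.of_rename_lam
  have h₀ : SpineRed (app (rename Nat.succ t) (var 0)) r := by
    refine ((hr.rename Nat.succ).app (var 0)).tail ?_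
    conv_rhs => rw [← contract_rename_liftRen_succ r]
    exact .beta _ _
  have hrq : BetaEq r (lam q) := .trans _ _ _ (.symm _ _ h₀.toBetaEq) hq.toBetaEq
  have htq : BetaEq t (lam (lam q)) :=
    .trans _ _ _ hr.toBetaEq (hrq.map fun _ _ => Beta.lam)
  have h₁ : SpineRed (expand t) q := by
    rw [expand, e]
    refine ((hq.rename Nat.succ).app (var 0)).tail ?_
    conv_rhs => rw [← contract_rename_liftRen_succ q]
    exact .beta _ _
  have hqn : BetaEq q ((app (var 0))^[n] (var 1)) :=
    .trans _ _ _ (.symm _ _ h₁.toBetaEq) h.betaStar.toBetaEq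
  exact .trans _ _ _ htq (hqn.map fun _ _ h => .lam (.lam h))

theorem betaEq_church_of_iterates {t : Term}
    (h : Iterates t.bound (t.bound + 1) n (app (app t (var t.bound)) (var (t.bound + 1)))) :
    BetaEq t (church n) := by
  -- The two fresh variables become `1` and `0`, and the variables of `t` move up by two, as in
  -- `expand`.
  let ρ : ℕ → ℕ := fun i => if i < t.bound then i + 2 else if i = t.bound then 1 else 0
  apply betaEq_church_of_iterates_expand
  have h' := h.rename ρ
  have e : rename ρ t = rename (· + 2) t := by
    rw [← subst_var_comp, ← subst_var_comp]
    exact subst_congr fun i hi => by simp [ρ, hi]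
  simpa [Term.rename, e, ρ, expand] using h'

/-- The term `s i` computes `(g)ⁱ x`; these are the templates for the suspended terms. -/
theorem Iterates.exists_seq {t : Term} (h : Iterates x g n t) :
    ∃ s : ℕ → Term, s n = t ∧ SpineRed (s 0) (var x) ∧
      ∀ i < n, SpineRed (s (i + 1)) (app (var g) (s i)) := by
  induction n generalizing t with
  | zero => exact ⟨fun _ => t, rfl, h, by simp⟩
  | succ n ih =>
    obtain ⟨b, hb, h⟩ := h
    obtain ⟨s, rfl, h₀, hs⟩ := ih h
    refine ⟨Function.update s (n + 1) t, by simp, by simpa using h₀, fun i hi => ?_⟩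
    rw [Function.update_of_ne (by omega : i ≠ n + 1)]
    obtain rfl | hi' := Nat.eq_or_lt_of_le (Nat.le_of_lt_succ hi)
    · simpa using hb
    · rw [Function.update_of_ne (by omega)]
      exact hs i hi'

/-! ### Suspended computations, named by variables -/

/-- `t` applied to a list of arguments. -/
def apps (t : Term) (π : List Term) : Term := π.foldl app t

theorem SpineRed.apps {t t' : Term} (h : SpineRed t t') (π : List Term) :
    SpineRed (apps t π) (apps t' π) := by
  induction π generalizing t t' with
  | nil => exact h
  | cons u π ih => exact ih (h.app u)

theorem SpineStep.apps {t t' : Term} (h : SpineStep t t') (π : List Term) :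
    SpineStep (apps t π) (apps t' π) := by
  induction π generalizing t t' with
  | nil => exact h
  | cons u π ih => exact ih (h.app u)

theorem subst_apps (σ : ℕ → Term) (t : Term) (π : List Term) :
    subst σ (apps t π) = apps (subst σ t) (π.map (subst σ)) := by
  induction π generalizing t with
  | nil => rfl
  | cons u π ih => exact ih (app t u)

/-- An injective numbering of terms. -/
def code : Term → ℕ
  | var i => Nat.pair 0 i
  | app t u => Nat.pair 1 (Nat.pair (code t) (code u))
  | lam t => Nat.pair 2 (code t)

theorem code_injective : Function.Injective code := by
  intro t
  induction t with
  | var i => intro u h; cases u <;> simp_all [code, Nat.pair_eq_pair]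
  | app a b iha ihb =>
    intro u h
    cases u with
    | app a' b' =>
      simp only [code, Nat.pair_eq_pair, true_and] at h
      rw [iha h.1, ihb h.2]
    | _ => simp [code, Nat.pair_eq_pair] at h
  | lam a ih =>
    intro u h
    cases u with
    | lam a' =>
      simp only [code, Nat.pair_eq_pair, true_and] at h
      rw [ih h]
    | _ => simp [code, Nat.pair_eq_pair] at h

/-- The name of a suspended term that computes `(b)ⁱ a`: a variable that is larger than `f + 1` and
than the variables of `a` and `b`. -/
def suspVar (f i : ℕ) (a b : Term) : ℕ :=
  Nat.pair (Nat.pair i (Nat.pair (code a) (code b))) (f + 2 + max a.bound b.bound)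

theorem le_suspVar (f i : ℕ) (a b : Term) : f + 2 + max a.bound b.bound ≤ suspVar f i a b :=
  Nat.right_le_pair _ _

theorem suspVar_inj {f i j : ℕ} {a b a' b' : Term} (h : suspVar f i a b = suspVar f j a' b') :
    i = j ∧ a = a' ∧ b = b' := by
  simp only [suspVar, Nat.pair_eq_pair] at h
  exact ⟨h.1.1, code_injective h.1.2.1, code_injective h.1.2.2⟩

/-- The terms from which weak head reduction leads to `f` applied to a numeral, when the variable
`f + 1` stands for an unknown representative of the numeral `n`.  Applied to `a` and `b`, it is
suspended, and the suspended terms are unfolded only when they come in head position. -/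
inductive Returns (f n : ℕ) : Term → Prop where
  | ret {t : Term} {m : ℕ} : BetaEq t (church m) → Returns f n (app (var f) t)
  | step {t t' : Term} : SpineStep t t' → Returns f n t' → Returns f n t
  | suspend (a b : Term) (π : List Term) : Returns f n (apps (var (suspVar f n a b)) π) →
      Returns f n (apps (app (app (var (f + 1)) a) b) π)
  | zero (a b : Term) (π : List Term) : Returns f n (apps a π) →
      Returns f n (apps (var (suspVar f 0 a b)) π)
  | succ {i : ℕ} (a b : Term) (π : List Term) : i < n →
      Returns f n (apps (app b (var (suspVar f i a b))) π) →
      Returns f n (apps (var (suspVar f (i + 1) a b)) π)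

/-- The substitution `σ` puts actual terms for the names of suspended computations. -/
structure Realizes (f n : ℕ) (σ : ℕ → Term) : Prop where
  apply_f : σ f = var f
  suspend (a b : Term) : app (app (σ (f + 1)) (subst σ a)) (subst σ b) = σ (suspVar f n a b)
  zero (a b : Term) : SpineRed (σ (suspVar f 0 a b)) (subst σ a)
  succ (i : ℕ) (a b : Term) : i < n →
    SpineRed (σ (suspVar f (i + 1) a b)) (app (subst σ b) (σ (suspVar f i a b)))

/-- The derivation does not mention `θ`, so `m` and `τ` are read off its leaf, uniformly in `σ`.
Each rule is simulated by weak head reduction, and `suspend` costs no step. -/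
theorem Returns.exists_spineRed {f n : ℕ} {t : Term} (h : Returns f n t) :
    ∃ (m : ℕ) (τ : Term), BetaEq τ (church m) ∧
      ∀ σ, Realizes f n σ → SpineRed (subst σ t) (app (var f) (subst σ τ)) := by
  induction h with
  | @ret t m h =>
    refine ⟨m, t, h, fun σ hσ => ?_⟩
    rw [subst, subst, hσ.apply_f]
  | step h _ ih =>
    obtain ⟨m, τ, hτ, ih⟩ := ih
    exact ⟨m, τ, hτ, fun σ hσ => (ih σ hσ).head (h.subst σ)⟩
  | suspend a b π _ ih =>
    obtain ⟨m, τ, hτ, ih⟩ := ih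
    refine ⟨m, τ, hτ, fun σ hσ => ?_⟩
    have := ih σ hσ
    rw [subst_apps] at this ⊢
    rwa [subst, ← hσ.suspend] at this
  | zero a b π _ ih =>
    obtain ⟨m, τ, hτ, ih⟩ := ih
    refine ⟨m, τ, hτ, fun σ hσ => .trans ?_ (ih σ hσ)⟩
    rw [subst_apps, subst_apps]
    exact (hσ.zero a b).apps _
  | succ a b π hi _ ih =>
    obtain ⟨m, τ, hτ, ih⟩ := ih
    refine ⟨m, τ, hτ, fun σ hσ => .trans ?_ (ih σ hσ)⟩
    rw [subst_apps, subst_apps]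
    exact (hσ.succ _ a b hi).apps _

/-- A substitution defined by course-of-values recursion on the variables. -/
def recSubst (F : ℕ → (ℕ → Term) → Term) (j : ℕ) : Term :=
  F j fun k => if _ : k < j then recSubst F k else var k

theorem exists_realizes {f n : ℕ} {θ : Term} (h : BetaEq θ (church n)) :
    ∃ σ, Realizes f n σ ∧ σ (f + 1) = θ := by
  classical
  obtain ⟨s, hn, h₀, hs⟩ := (iterates_expand h).exists_seq
  let F : ℕ → (ℕ → Term) → Term := fun j τ =>
    if h : ∃ p : ℕ × Term × Term, j = suspVar f p.1 p.2.1 p.2.2 then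
      -- In `s i`, the variable `0` is the iterated function and `1` the starting point. Every other
      -- variable comes down by two, undoing the shift of `expand`.
      subst (cons (subst τ h.choose.2.2) (cons (subst τ h.choose.2.1) var)) (s h.choose.1)
    else if j = f + 1 then θ else var j
  have hF (i : ℕ) (a b : Term) (τ : ℕ → Term) :
      F (suspVar f i a b) τ = subst (cons (subst τ b) (cons (subst τ a) var)) (s i) := by
    have h : ∃ p : ℕ × Term × Term, suspVar f i a b = suspVar f p.1 p.2.1 p.2.2 := ⟨(i, a, b), rfl⟩
    obtain ⟨h₁, h₂, h₃⟩ := suspVar_inj h.choose_spec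
    simp only [F, dif_pos h, ← h₁, ← h₂, ← h₃]
  have hF' (j : ℕ) (hj : j < f + 2) (τ : ℕ → Term) :
      F j τ = if j = f + 1 then θ else var j := by
    refine dif_neg ?_
    rintro ⟨p, hp⟩
    have := le_suspVar f p.1 p.2.1 p.2.2
    omega
  let σ := recSubst F
  have hsusp (i : ℕ) (a b : Term) : σ (suspVar f i a b) =
      subst (cons (subst σ b) (cons (subst σ a) var)) (s i) := by
    have hlt := le_suspVar f i a b
    have hle := le_max_left a.bound b.bound
    have hle' := le_max_right a.bound b.bound
    simp only [σ]
    rw [recSubst, hF]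
    congr 2
    -- A name exceeds all variables of its `a` and `b`, so the recursion never meets its default
    -- value.
    · exact subst_congr fun k hk => dif_pos (by omega)
    · congr 1
      exact subst_congr fun k hk => dif_pos (by omega)
  have hθ : σ (f + 1) = θ := by
    simp only [σ]
    rw [recSubst, hF' _ (by omega), if_pos rfl]
  refine ⟨σ, ⟨?_, fun a b => ?_, fun a b => ?_, fun i a b hi => ?_⟩, hθ⟩
  · simp only [σ]
    rw [recSubst, hF' _ (by omega), if_neg (by omega)]
  · rw [hsusp, hn, hθ, expand]
    simp only [subst, subst_rename]
    conv_lhs => rw [← subst_var θ]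
    rfl
  · rw [hsusp]
    exact h₀.subst _
  · rw [hsusp, hsusp]
    exact (hs i hi).subst _

/-! ### Saturated sets -/

/-- Closure under weak head expansion. -/
def Saturated (S : Set Term) : Prop := ∀ ⦃t t'⦄, SpineStep t t' → t' ∈ S → t ∈ S

/-- The terms that belong to `B` when they are applied to any of a set of argument lists. -/
def IsOrth (B S : Set Term) : Prop :=
  ∃ P : Set (List Term), ∀ t, t ∈ S ↔ ∀ π ∈ P, apps t π ∈ B

variable {B S : Set Term}

theorem IsOrth.saturated (hB : Saturated B) (h : IsOrth B S) : Saturated S := by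
  obtain ⟨P, hP⟩ := h
  intro t t' ht ht'
  rw [hP] at ht' ⊢
  exact fun π hπ => hB (ht.apps π) (ht' π hπ)

theorem isOrth_self (B : Set Term) : IsOrth B B :=
  ⟨{[]}, fun t => by simp [apps]⟩

theorem IsOrth.arrow (R : Set Term) (h : IsOrth B S) :
    IsOrth B {t | ∀ u ∈ R, app t u ∈ S} := by
  obtain ⟨P, hP⟩ := h
  refine ⟨{π | ∃ u ∈ R, ∃ π' ∈ P, π = u :: π'}, fun t => ?_⟩
  simp only [Set.mem_ofPred_eq, hP]
  constructor
  · rintro h _ ⟨u, hu, π, hπ, rfl⟩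
    exact h u hu π hπ
  · exact fun h u hu π hπ => h _ ⟨u, hu, π, hπ, rfl⟩

theorem IsOrth.iInter {ι : Type*} {Q : ι → Prop} {S : ι → Set Term}
    (h : ∀ i, Q i → IsOrth B (S i)) : IsOrth B {t | ∀ i, Q i → t ∈ S i} := by
  choose! P hP using h
  refine ⟨{π | ∃ i, Q i ∧ π ∈ P i}, fun t => ?_⟩
  constructor
  · rintro h π ⟨i, hi, hπ⟩
    exact (hP i hi t).1 (h i hi) π hπ
  · exact fun h i hi => (hP i hi t).2 fun π hπ => h π ⟨i, hi, hπ⟩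

/-- The context bounds the free variables; in particular a term typed in the empty context is
closed. -/
theorem subst_eq_self {C : Type*} {Γ : List (Ty C)} {t : Term} {A : Ty C} (h : Typing Γ t A)
    {σ : ℕ → Term} (hσ : ∀ i < Γ.length, σ i = var i) : subst σ t = t := by
  induction h generalizing σ with
  | var h => exact hσ _ (List.getElem?_eq_some_iff.1 h).1
  | lam _ ih =>
    rw [subst, ih]
    rintro (_ | i) hi
    · rfl
    · rw [liftSubst, hσ i (by simpa using hi)]
      rfl
  | app _ _ iht ihu => rw [subst, iht hσ, ihu hσ]
  | gen _ _ ih => exact ih (by simpa using hσ)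
  | instOrd _ _ ih => exact ih hσ
  | instPerp _ _ _ ih => exact ih hσ

end Term

/-! ### Realizability interpretation of types -/

namespace Ty

open Term

variable {C : Type*} {B : Set Term}

/-- The sets over which the variables of each kind range. -/
def Admissible (B : Set Term) : Kind → Set Term → Prop
  | .ord => Saturated
  | .perp => IsOrth B

theorem Admissible.saturated (hB : Saturated B) {k : Kind} {S : Set Term}
    (h : Admissible B k S) : Saturated S := by
  cases k with
  | ord => exact h
  | perp => exact IsOrth.saturated hB h

/-- The extension of a valuation under a quantifier of kind `k`. -/
def extend (k : Kind) (S : Set Term) (ρ : Kind → ℕ → Set Term) (k' : Kind) : ℕ → Set Term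
  | 0 => if k' = k then S else ρ k' 0
  | i + 1 => if k' = k then ρ k' i else ρ k' (i + 1)

/-- The set of terms that realize a type. -/
def interp (B : Set Term) : (Kind → ℕ → Set Term) → Ty C → Set Term
  | _, bot => B
  | _, const _ => Set.univ
  | ρ, var k i => ρ k i
  | ρ, arr A A' => {t | ∀ u ∈ interp B ρ A, Term.app t u ∈ interp B ρ A'}
  | ρ, all k A => {t | ∀ S, Admissible B k S → t ∈ interp B (extend k S ρ) A}

theorem interp_rename (ρ : Kind → ℕ → Set Term) (r : Kind → ℕ → ℕ) (A : Ty C) :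
    interp B ρ (rename r A) = interp B (fun k i => ρ k (r k i)) A := by
  induction A generalizing ρ r with
  | bot => rfl
  | const c => rfl
  | var k i => rfl
  | arr A A' ih ih' => simp only [rename, interp, ih, ih']
  | all k A ih =>
    have e (S : Set Term) : (fun k' i => extend k S ρ k' (liftRen k r k' i)) =
        extend k S fun k' i => ρ k' (r k' i) := by
      funext k' i
      by_cases h : k' = k
      · cases i <;> simp [extend, liftRen, h]
      · have h' (ρ : Kind → ℕ → Set Term) (j : ℕ) : extend k S ρ k' j = ρ k' j := by
          cases j <;> simp [extend, h]
        rw [h', h']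
        cases i <;> simp [liftRen, h]
    simp only [rename, interp, ih, e]

theorem interp_weaken (k : Kind) (S : Set Term) (ρ : Kind → ℕ → Set Term) (A : Ty C) :
    interp B (extend k S ρ) (weaken k A) = interp B ρ A := by
  rw [weaken, interp_rename]
  congr 1
  funext k' i
  by_cases h : k' = k
  · simp [extend, shift, h]
  · cases i <;> simp [extend, shift, h]

theorem interp_subst (ρ : Kind → ℕ → Set Term) (σ : Kind → ℕ → Ty C) (A : Ty C) :
    interp B ρ (subst σ A) = interp B (fun k i => interp B ρ (σ k i)) A := by
  induction A generalizing ρ σ with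
  | bot => rfl
  | const c => rfl
  | var k i => rfl
  | arr A A' ih ih' => simp only [subst, interp, ih, ih']
  | all k A ih =>
    have e (S : Set Term) : (fun k' i => interp B (extend k S ρ) (liftSubst k σ k' i)) =
        extend k S fun k' i => interp B ρ (σ k' i) := by
      funext k' i
      by_cases h : k' = k
      · cases i <;> simp [extend, liftSubst, h, interp_weaken, interp]
      · cases i <;> simp [extend, liftSubst, h, interp_weaken]
    simp only [subst, interp, ih, e]

theorem interp_inst (k : Kind) (ρ : Kind → ℕ → Set Term) (A G : Ty C) :
    interp B ρ (inst k A G) = interp B (extend k (interp B ρ G) ρ) A := by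
  rw [inst, interp_subst]
  congr 1
  funext k' i
  by_cases h : k' = k <;> cases i <;> simp [extend, single, h, interp]

theorem admissible_extend {k : Kind} {S : Set Term} {ρ : Kind → ℕ → Set Term}
    (hS : Admissible B k S) (hρ : ∀ k i, Admissible B k (ρ k i)) (k' : Kind) (i : ℕ) :
    Admissible B k' (extend k S ρ k' i) := by
  by_cases h : k' = k
  · subst h
    cases i <;> simp [extend, hS, hρ]
  · cases i <;> simp [extend, h, hρ]

theorem saturated_interp (hB : Saturated B) {ρ : Kind → ℕ → Set Term}
    (hρ : ∀ k i, Admissible B k (ρ k i)) (A : Ty C) : Saturated (interp B ρ A) := by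
  induction A generalizing ρ with
  | bot => exact hB
  | const c => exact fun _ _ _ _ => trivial
  | var k i => exact (hρ k i).saturated hB
  | arr A A' _ ih => exact fun t t' h ht u hu => ih hρ (h.app u) (ht u hu)
  | all k A ih => exact fun t t' h ht S hS => ih (admissible_extend hS hρ) h (ht S hS)

/-- This makes instantiation by `⊥`-types sound: being an orthogonal survives intersections and
arrows with an arbitrary domain. -/
theorem IsPerp.isOrth_interp {A : Ty C} (hA : A.IsPerp) {ρ : Kind → ℕ → Set Term}
    (hρ : ∀ k i, Admissible B k (ρ k i)) : IsOrth B (interp B ρ A) := by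
  induction hA generalizing ρ with
  | bot => exact isOrth_self B
  | var i => exact hρ Kind.perp i
  | arr A _ ih => exact (ih hρ).arrow _
  | all k _ ih => exact IsOrth.iInter fun S hS => ih (admissible_extend hS hρ)

end Ty

open Term in
/-- Every typable term realizes its type. -/
theorem Typing.mem_interp {C : Type*} {B : Set Term} (hB : Saturated B) {Γ : List (Ty C)}
    {t : Term} {A : Ty C} (h : Typing Γ t A) {ρ : Kind → ℕ → Set Term}
    (hρ : ∀ k i, Ty.Admissible B k (ρ k i)) {σ : ℕ → Term}
    (hσ : ∀ i A, Γ[i]? = some A → σ i ∈ Ty.interp B ρ A) : subst σ t ∈ Ty.interp B ρ A := by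
  induction h generalizing ρ σ with
  | var h => exact hσ _ _ h
  | lam _ ih =>
    intro u hu
    refine Ty.saturated_interp hB hρ _ (.beta _ _) ?_
    rw [contract_subst_liftSubst]
    refine ih hρ fun i A hi => ?_
    cases i with
    | zero => cases hi; exact hu
    | succ i => exact hσ i A hi
  | app _ _ iht ihu => exact iht hρ hσ _ (ihu hρ hσ)
  | gen k _ ih =>
    intro S hS
    refine ih (Ty.admissible_extend hS hρ) fun i A hi => ?_
    rw [List.getElem?_map, Option.map_eq_some_iff] at hi
    obtain ⟨A, hi, rfl⟩ := hi
    rw [Ty.interp_weaken]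
    exact hσ i A hi
  | instOrd G _ ih =>
    rw [Ty.interp_inst]
    exact ih hρ hσ _ (Ty.saturated_interp hB hρ G)
  | instPerp G hG _ ih =>
    rw [Ty.interp_inst]
    exact ih hρ hσ _ (hG.isOrth_interp hρ)

namespace Term

/-! ### Numerals as realizers -/

theorem saturated_returns (f n : ℕ) : Saturated {t | Returns f n t} :=
  fun _ _ h h' => Returns.step h h'

/-- Membership in an orthogonal `S` is decided by applying to argument lists and landing in `Returns
f n`, which is what the rules for names in head position provide. A merely saturated `S` need not
contain these names. -/
theorem var_mem_interp_natPerp (C : Type*) (f n : ℕ) (ρ : Kind → ℕ → Set Term) :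
    var (f + 1) ∈ Ty.interp {t | Returns f n t} ρ (Ty.natPerp : Ty C) := by
  rintro S ⟨P, hP⟩ a (ha : a ∈ S) b (hb : ∀ u ∈ S, app b u ∈ S)
  -- The rule `succ` only unfolds names of index at most `n`.
  have hsusp : ∀ i ≤ n, var (suspVar f i a b) ∈ S := by
    intro i
    induction i with
    | zero => exact fun _ => (hP _).2 fun π hπ => .zero a b π ((hP a).1 ha π hπ)
    | succ i ih =>
      exact fun hi => (hP _).2 fun π hπ =>
        .succ a b π hi ((hP _).1 (hb _ (ih (Nat.le_of_succ_le hi))) π hπ)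
  exact (hP _).2 fun π hπ => .suspend a b π ((hP _).1 (hsusp n le_rfl) π hπ)

/-- The ordinary variable may denote any saturated set, here the iterates over two variables fresh
for `t`. -/
theorem exists_betaEq_church_of_mem_interp_nat {C : Type*} {B : Set Term}
    {ρ : Kind → ℕ → Set Term} {t : Term} (h : t ∈ Ty.interp B ρ (Ty.nat : Ty C)) :
    ∃ m, BetaEq t (church m) := by
  have hS : Saturated {u | ∃ m, Iterates t.bound (t.bound + 1) m u} :=
    fun u u' hu ⟨m, hm⟩ => ⟨m, hm.spineRed (.single hu)⟩
  obtain ⟨m, hm⟩ := h _ hS (var t.bound) ⟨0, .refl⟩ (var (t.bound + 1))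
    fun u ⟨m, hm⟩ => ⟨m + 1, u, .refl, hm⟩
  exact ⟨m, betaEq_church_of_iterates hm⟩

end Term

end FPerp

theorem theorem5p2 {C : Type*} (T : FPerp.Term)
    (hT : FPerp.Typing ([] : List (FPerp.Ty C)) T
      (FPerp.Ty.arr FPerp.Ty.natPerp (FPerp.Ty.neg (FPerp.Ty.neg FPerp.Ty.nat))))
    (f n : ℕ) :
    ∃ (m : ℕ) (τ : FPerp.Term), FPerp.Term.BetaEq τ (FPerp.Term.church m) ∧
      ∀ θ : FPerp.Term, FPerp.Term.BetaEq θ (FPerp.Term.church n) →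
        ∃ σ : ℕ → FPerp.Term,
          FPerp.Term.HeadRed
            (FPerp.Term.app (FPerp.Term.app T θ) (FPerp.Term.var f))
            (FPerp.Term.app (FPerp.Term.var f) (FPerp.Term.subst σ τ)) := by
  -- Some admissible valuation is needed; the constant one at `Returns f n` serves both kinds.
  have hρ (k : FPerp.Kind) (_ : ℕ) :
      FPerp.Ty.Admissible {t | FPerp.Term.Returns f n t} k {t | FPerp.Term.Returns f n t} := by
    cases k with
    | ord => exact FPerp.Term.saturated_returns f n
    | perp => exact FPerp.Term.isOrth_self _
  have hT' := hT.mem_interp (FPerp.Term.saturated_returns f n) hρ (σ := FPerp.Term.var)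
    (by simp)
  rw [FPerp.Term.subst_var] at hT'
  -- Here `f + 1` takes the place of `θ`, and `f` realizes `¬N` by the rule `ret`.
  have hret : FPerp.Term.Returns f n (.app (.app T (.var (f + 1))) (.var f)) :=
    hT' _ (FPerp.Term.var_mem_interp_natPerp C f n _) (.var f) fun t ht =>
      (FPerp.Term.exists_betaEq_church_of_mem_interp_nat ht).elim fun _ h => .ret h
  obtain ⟨m, τ, hτ, hred⟩ := hret.exists_spineRed
  refine ⟨m, τ, hτ, fun θ hθ => ?_⟩
  obtain ⟨σ, hσ, hσθ⟩ := FPerp.Term.exists_realizes (f := f) hθ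
  refine ⟨σ, ?_⟩
  have h := (hred σ hσ).toHeadRed
  rwa [FPerp.Term.subst, FPerp.Term.subst, FPerp.Term.subst, FPerp.Term.subst,
    FPerp.Term.subst_eq_self hT (by simp), hσθ, hσ.apply_f] at h
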